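/- For real $\epsilon,\epsilon'$, $\zeta\in\mathbb{C}$ and $\tau\in\mathbb{C}$ with $\operatorname{Im}\tau>0$, let $$\theta\left[\begin{array}{c}\epsilon\\ \epsilon'\end{array}\right](\zeta,\tau)=\sum_{n\in\mathbb{Z}}\exp\left(2\pi i\left[\tfrac12\left(n+\tfrac{\epsilon}{2}\right)^2\tau+\left(n+\tfrac{\epsilon}{2}\right)\left(\zeta+\tfrac{\epsilon'}{2}\right)\right]\right),$$ and write $\theta[\epsilon;\epsilon'](\zeta,\tau)$ for this function and $\theta'[\epsilon;\epsilon'](0,\tau)=\frac{\partial}{\partial\zeta}\theta[\epsilon;\epsilon'](\zeta,\tau)\big|_{\zeta=0}$. **Theorem.** For every $\tau\in\mathbb{C}$ with $\operatorname{Im}\tau>0$, the values $\theta[0;\tfrac14](0,\tau)$ and $\theta[0;\tfrac34](0,\tau)$ are nonzero, and the following four identities hold: $$\frac{\theta'[0;\frac14](0,\tau)}{\theta[0;\frac14](0,\tau)}-\frac{\theta'[0;\frac34](0,\tau)}{\theta[0;\frac34](0,\tau)}=2\pi\,\theta[1;0](0,4\tau)^2,$$ $$\frac{\theta'[0;\frac14](0,\tau)}{\theta[0;\frac14](0,\tau)}+\frac{\theta'[0;\frac34](0,\tau)}{\theta[0;\frac34](0,\tau)}=-2\sqrt2\,\pi\,\theta[1;0](0,4\tau)\,\theta[0;0](0,2\tau),$$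 $$\theta'[0;\tfrac14](0,\tau)=-\pi\,\theta[0;\tfrac14](0,\tau)\,\theta[1;0](0,4\tau)\left\{\sqrt2\,\theta[0;0](0,2\tau)-\theta[1;0](0,4\tau)\right\},$$ $$\theta'[0;\tfrac34](0,\tau)=-\pi\,\theta[0;\tfrac34](0,\tau)\,\theta[1;0](0,4\tau)\left\{\sqrt2\,\theta[0;0](0,2\tau)+\theta[1;0](0,4\tau)\right\}.$$ -/

import Mathlib

/-- The general term of the theta series with real characteristics `ε`, `ε'`. -/
noncomputable def thetaCharTerm (ε ε' : ℝ) (ζ τ : ℂ) (n : ℤ) : ℂ :=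
  Complex.exp (2 * Real.pi * Complex.I *
    (1 / 2 * ((n : ℂ) + (ε : ℂ) / 2) ^ 2 * τ + ((n : ℂ) + (ε : ℂ) / 2) * (ζ + (ε' : ℂ) / 2)))

/-- The theta function with characteristics `θ[ε; ε'](ζ, τ)`
(in the convention of Farkas and Kra), meant for `τ` in the upper half plane. -/
noncomputable def thetaChar (ε ε' : ℝ) (ζ τ : ℂ) : ℂ :=
  ∑' n : ℤ, thetaCharTerm ε ε' ζ τ n

/-- The theta derivative `θ'[ε; ε'](0, τ)`: the derivative in `ζ` at `ζ = 0`. -/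
noncomputable def thetaCharDeriv (ε ε' : ℝ) (τ : ℂ) : ℂ :=
  deriv (fun ζ : ℂ => thetaChar ε ε' ζ τ) 0

theorem thetaCharTerm_eq (ε ε' : ℝ) (ζ τ : ℂ) (n : ℤ) :
    thetaCharTerm ε ε' ζ τ n =
      Complex.exp (2 * Real.pi * Complex.I *
          ((ε : ℂ) ^ 2 / 8 * τ + (ε : ℂ) / 2 * (ζ + (ε' : ℂ) / 2))) *
        jacobiTheta₂_term n (ζ + (ε' : ℂ) / 2 + (ε : ℂ) / 2 * τ) τ := by
  rw [thetaCharTerm, jacobiTheta₂_term, ← Complex.exp_add]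
  congr 1
  ring

/-- In the upper half plane the theta series converges (absolutely). -/
theorem summable_thetaCharTerm (ε ε' : ℝ) (ζ : ℂ) {τ : ℂ} (hτ : 0 < τ.im) :
    Summable (thetaCharTerm ε ε' ζ τ) := by
  have h := (summable_jacobiTheta₂_term_iff (ζ + (ε' : ℂ) / 2 + (ε : ℂ) / 2 * τ) τ).2 hτ
  exact (h.mul_left _).congr fun n => (thetaCharTerm_eq ε ε' ζ τ n).symm

theorem thetaChar_eq (ε ε' : ℝ) (ζ τ : ℂ) :
    thetaChar ε ε' ζ τ =
      Complex.exp (2 * Real.pi * Complex.I *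
          ((ε : ℂ) ^ 2 / 8 * τ + (ε : ℂ) / 2 * (ζ + (ε' : ℂ) / 2))) *
        jacobiTheta₂ (ζ + (ε' : ℂ) / 2 + (ε : ℂ) / 2 * τ) τ := by
  rw [thetaChar, jacobiTheta₂, ← tsum_mul_left]
  exact tsum_congr fun n => thetaCharTerm_eq ε ε' ζ τ n

/-- In the upper half plane the theta function is holomorphic in `ζ`. -/
theorem differentiable_thetaChar (ε ε' : ℝ) {τ : ℂ} (hτ : 0 < τ.im) :
    Differentiable ℂ (fun ζ : ℂ => thetaChar ε ε' ζ τ) := by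
  intro ζ
  simp only [thetaChar_eq]
  have h := differentiableAt_jacobiTheta₂_fst (ζ + (ε' : ℂ) / 2 + (ε : ℂ) / 2 * τ) hτ
  have h2 : DifferentiableAt ℂ
      (fun ζ : ℂ => jacobiTheta₂ (ζ + (ε' : ℂ) / 2 + (ε : ℂ) / 2 * τ) τ) ζ :=
    DifferentiableAt.comp (f := fun ζ : ℂ => ζ + (ε' : ℂ) / 2 + (ε : ℂ) / 2 * τ)
      (g := fun z : ℂ => jacobiTheta₂ z τ) ζ h (by fun_prop)
  exact DifferentiableAt.mul (by fun_prop) h2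

/-! ### Reindexing by parity and the addition formula. -/

open Filter Topology

/-! Write θ₀, θ₁ for characteristics 0, 1. The four numbers to compare are values and derivatives of
θ₀(·,τ) at 1/8 and 3/8. The addition formula at (3/8, −1/8) leads to the arguments 1/4 and 1/2 at
2τ, where θ₁(1/2) = θ₀'(1/2) = 0 removes most terms. Its derivatives in the directions (1,1) and
(1,−1) give the difference and the sum of the two logarithmic derivatives.

What remains is evaluated by Jacobi's derivative formula (`deriv_thetaChar_one_half`) and by
`thetaChar_one_zero_mul_quarter_eq`. Each says that a quotient of theta constants is constant:
addition formulas make it invariant under τ ↦ 2τ, and its limit along 2^k τ gives the value.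
Nonvanishing follows likewise: a zero would persist along 2^k τ, against a nonzero limit. -/

theorem HasSum.int_mul_parity {f : ℤ × ℤ → ℂ} {s t : ℂ}
    (hs : HasSum (fun p : ℤ × ℤ => f (p.1 + p.2, p.1 - p.2)) s)
    (ht : HasSum (fun p : ℤ × ℤ => f (p.1 + p.2 + 1, p.1 - p.2)) t) : HasSum f (s + t) := by
  let g : (ℤ × ℤ) ⊕ (ℤ × ℤ) → ℤ × ℤ :=
    Sum.elim (fun p => (p.1 + p.2, p.1 - p.2)) (fun p => (p.1 + p.2 + 1, p.1 - p.2))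
  have hg : Function.Bijective g := by
    constructor
    · rintro (⟨a, b⟩ | ⟨a, b⟩) (⟨c, d⟩ | ⟨c, d⟩) h <;>
        simp only [g, Sum.elim_inl, Sum.elim_inr, Prod.mk.injEq] at h
      · obtain ⟨rfl, rfl⟩ : a = c ∧ b = d := by omega
        rfl
      · omega
      · omega
      · obtain ⟨rfl, rfl⟩ : a = c ∧ b = d := by omega
        rfl
    · rintro ⟨m, n⟩
      rcases Int.even_or_odd' (m + n) with ⟨k, hk | hk⟩
      · exact ⟨Sum.inl (k, m - k), by simp only [g, Sum.elim_inl, Prod.mk.injEq]; omega⟩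
      · exact ⟨Sum.inr (k, m - k - 1), by simp only [g, Sum.elim_inr, Prod.mk.injEq]; omega⟩
  rw [← (Equiv.ofBijective g hg).hasSum_iff]
  exact HasSum.sum hs ht

theorem HasSum.int_parity {f : ℤ → ℂ} {s t : ℂ}
    (hs : HasSum (fun n : ℤ => f (2 * n)) s)
    (ht : HasSum (fun n : ℤ => f (2 * n + 1)) t) : HasSum f (s + t) := by
  let g : ℤ ⊕ ℤ → ℤ := Sum.elim (fun n => 2 * n) (fun n => 2 * n + 1)
  have hg : Function.Bijective g := by
    constructor
    · rintro (a | a) (b | b) h <;> simp only [g, Sum.elim_inl, Sum.elim_inr] at h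
      · obtain rfl : a = b := by omega
        rfl
      · omega
      · omega
      · obtain rfl : a = b := by omega
        rfl
    · intro m
      rcases Int.even_or_odd' m with ⟨k, hk | hk⟩
      · exact ⟨Sum.inl k, hk.symm⟩
      · exact ⟨Sum.inr k, hk.symm⟩
  rw [← (Equiv.ofBijective g hg).hasSum_iff]
  exact HasSum.sum hs ht

theorem hasSum_thetaChar (ε ε' : ℝ) (ζ : ℂ) {τ : ℂ} (hτ : 0 < τ.im) :
    HasSum (thetaCharTerm ε ε' ζ τ) (thetaChar ε ε' ζ τ) :=
  (summable_thetaCharTerm ε ε' ζ hτ).hasSum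

theorem im_natCast_mul_pos {τ : ℂ} (hτ : 0 < τ.im) {n : ℕ} (hn : n ≠ 0) :
    0 < ((n : ℂ) * τ).im := by
  have : (0 : ℝ) < n := by positivity
  simpa using mul_pos this hτ

theorem im_two_mul_pos {τ : ℂ} (hτ : 0 < τ.im) : 0 < (2 * τ).im := by
  simpa using hτ

theorem hasSum_thetaCharTerm_mul (ε δ : ℝ) (x y : ℂ) {τ : ℂ} (hτ : 0 < τ.im) :
    HasSum (fun p : ℤ × ℤ => thetaCharTerm ε 0 x τ p.1 * thetaCharTerm δ 0 y τ p.2)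
      (thetaChar ε 0 x τ * thetaChar δ 0 y τ) := by
  have h1 := summable_thetaCharTerm ε 0 x hτ
  have h2 := summable_thetaCharTerm δ 0 y hτ
  have h := summable_mul_of_summable_norm h1.norm h2.norm
  exact (hasSum_thetaChar ε 0 x hτ).mul (hasSum_thetaChar δ 0 y hτ) h

/-- The addition formula for theta functions with equal characteristics. -/
theorem thetaChar_mul_thetaChar (ε : ℝ) (x y : ℂ) {τ : ℂ} (hτ : 0 < τ.im) :
    thetaChar ε 0 x τ * thetaChar ε 0 y τ =
      thetaChar ε 0 (x + y) (2 * τ) * thetaChar 0 0 (x - y) (2 * τ) +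
      thetaChar (ε + 1) 0 (x + y) (2 * τ) * thetaChar 1 0 (x - y) (2 * τ) := by
  -- For m = a+b, n = a−b one has m²+n² = 2(a²+b²), hence the modulus 2τ. In the odd class, m+ε/2
  -- and n+ε/2 are the sum and difference of a+(ε+1)/2 and b+1/2, so both characteristics rise by 1.
  refine (hasSum_thetaCharTerm_mul ε ε x y hτ).unique (HasSum.int_mul_parity ?_ ?_)
  · refine (hasSum_thetaCharTerm_mul ε 0 (x + y) (x - y) (im_two_mul_pos hτ)).congr_fun ?_
    intro p
    simp only [thetaCharTerm, ← Complex.exp_add]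
    congr 1
    push_cast
    ring
  · refine (hasSum_thetaCharTerm_mul (ε + 1) 1 (x + y) (x - y) (im_two_mul_pos hτ)).congr_fun ?_
    intro p
    simp only [thetaCharTerm, ← Complex.exp_add]
    congr 1
    push_cast
    ring

/-! ### Symmetries and special zeros. -/

theorem thetaChar_add_two (ε ε' : ℝ) (ζ τ : ℂ) :
    thetaChar (ε + 2) ε' ζ τ = thetaChar ε ε' ζ τ := by
  rw [thetaChar, thetaChar, ← (Equiv.addRight (1 : ℤ)).tsum_eq (thetaCharTerm ε ε' ζ τ)]
  refine tsum_congr fun n => ?_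
  simp only [thetaCharTerm, Equiv.coe_addRight]
  congr 1
  push_cast
  ring

theorem thetaChar_neg (ε : ℝ) (ζ τ : ℂ) :
    thetaChar (-ε) 0 (-ζ) τ = thetaChar ε 0 ζ τ := by
  rw [thetaChar, thetaChar, ← (Equiv.neg ℤ).tsum_eq (thetaCharTerm ε 0 ζ τ)]
  refine tsum_congr fun n => ?_
  simp only [thetaCharTerm, Equiv.neg_apply]
  congr 1
  push_cast
  ring

theorem thetaChar_zero_neg (ζ τ : ℂ) : thetaChar 0 0 (-ζ) τ = thetaChar 0 0 ζ τ := by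
  simpa using thetaChar_neg 0 ζ τ

theorem thetaChar_one_neg (ζ τ : ℂ) : thetaChar 1 0 (-ζ) τ = thetaChar 1 0 ζ τ := by
  rw [← thetaChar_neg 1 ζ τ, ← thetaChar_add_two (-1)]
  norm_num

theorem thetaChar_add_one (ε : ℝ) (ζ τ : ℂ) :
    thetaChar ε 0 (ζ + 1) τ = Complex.exp (Real.pi * Complex.I * ε) * thetaChar ε 0 ζ τ := by
  rw [thetaChar, thetaChar, ← tsum_mul_left]
  refine tsum_congr fun n => ?_
  simp only [thetaCharTerm, ← Complex.exp_add]
  refine Complex.exp_eq_exp_iff_exists_int.2 ⟨n, ?_⟩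
  ring

theorem thetaChar_zero_add_one (ζ τ : ℂ) : thetaChar 0 0 (ζ + 1) τ = thetaChar 0 0 ζ τ := by
  simpa using thetaChar_add_one 0 ζ τ

theorem thetaChar_one_add_one (ζ τ : ℂ) : thetaChar 1 0 (ζ + 1) τ = -thetaChar 1 0 ζ τ := by
  simpa using thetaChar_add_one 1 ζ τ

/-- Evenness and antiperiodicity under ζ ↦ ζ+1 conflict at 1/2. -/
theorem thetaChar_one_half (τ : ℂ) : thetaChar 1 0 (1 / 2) τ = 0 := by
  have h := thetaChar_one_add_one (-(1 / 2)) τ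
  rw [thetaChar_one_neg, show (-(1 / 2) + 1 : ℂ) = 1 / 2 by norm_num] at h
  exact self_eq_neg.1 h

theorem thetaChar_char (ε ε' : ℝ) (ζ τ : ℂ) :
    thetaChar ε ε' ζ τ = thetaChar ε 0 (ζ + (ε' : ℂ) / 2) τ := by
  simp [thetaChar, thetaCharTerm]

/-- Splitting of the theta series into its terms of even and of odd index. -/
theorem thetaChar_zero_eq_add (ζ : ℂ) {τ : ℂ} (hτ : 0 < τ.im) :
    thetaChar 0 0 ζ τ = thetaChar 0 0 (2 * ζ) (4 * τ) + thetaChar 1 0 (2 * ζ) (4 * τ) := by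
  have h4 : 0 < (4 * τ).im := im_natCast_mul_pos hτ (n := 4) (by norm_num)
  refine (hasSum_thetaChar 0 0 ζ hτ).unique (HasSum.int_parity ?_ ?_)
  · refine (hasSum_thetaChar 0 0 (2 * ζ) h4).congr_fun fun n => ?_
    simp only [thetaCharTerm]
    congr 1
    push_cast
    ring
  · refine (hasSum_thetaChar 1 0 (2 * ζ) h4).congr_fun fun n => ?_
    simp only [thetaCharTerm]
    congr 1
    push_cast
    ring

/-! ### Termwise derivatives and limits along 2^k τ. -/

theorem hasDerivAt_thetaChar (ε : ℝ) (ζ : ℂ) {τ : ℂ} (hτ : 0 < τ.im) :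
    HasDerivAt (fun z => thetaChar ε 0 z τ) (deriv (fun z => thetaChar ε 0 z τ) ζ) ζ :=
  (differentiable_thetaChar ε 0 hτ ζ).hasDerivAt

theorem hasSum_deriv_thetaChar (ε : ℝ) (ζ : ℂ) {τ : ℂ} (hτ : 0 < τ.im) :
    HasSum (fun n : ℤ => 2 * Real.pi * Complex.I * (n + (ε : ℂ) / 2) * thetaCharTerm ε 0 ζ τ n)
      (deriv (fun z => thetaChar ε 0 z τ) ζ) := by
  let w : ℂ → ℂ := fun z => z + ((0 : ℝ) : ℂ) / 2 + (ε : ℂ) / 2 * τ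
  let e : ℂ → ℂ := fun z => Complex.exp (2 * Real.pi * Complex.I *
          ((ε : ℂ) ^ 2 / 8 * τ + (ε : ℂ) / 2 * (z + ((0 : ℝ) : ℂ) / 2)))
  have hw : HasDerivAt w 1 ζ := ((hasDerivAt_id ζ).add_const _).add_const _
  have he : HasDerivAt e (e ζ * (2 * Real.pi * Complex.I * ((ε : ℂ) / 2 * 1))) ζ :=
    ((((hasDerivAt_id ζ).add_const _).const_mul _ |>.const_add _).const_mul _).cexp
  have hj : HasDerivAt (fun z => jacobiTheta₂ (w z) τ) (jacobiTheta₂' (w ζ) τ * 1) ζ :=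
    (hasDerivAt_jacobiTheta₂_fst (w ζ) hτ).comp ζ hw
  have h : HasDerivAt (fun z => thetaChar ε 0 z τ) _ ζ :=
    (he.mul hj).congr_of_eventuallyEq (.of_forall fun z => thetaChar_eq ε 0 z τ)
  rw [h.deriv]
  refine HasSum.congr_fun (((hasSum_jacobiTheta₂_term (w ζ) hτ).mul_left _).add
    (((hasSum_jacobiTheta₂'_term (w ζ) hτ).mul_right 1).mul_left _)) fun n => ?_
  rw [thetaCharTerm_eq, jacobiTheta₂'_term]
  ring

/-- Termwise limit of a series of powers of `exp (π i τ)` along `τ, 2 τ, 4 τ, …`. -/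
theorem tendsto_tsum_exp_two_pow {τ : ℂ} (hτ : 0 < τ.im) (c : ℤ → ℕ) (a : ℤ → ℂ)
    (h : Summable fun n => a n * Complex.exp (Real.pi * Complex.I * c n * τ)) :
    Tendsto (fun k : ℕ => ∑' n, a n * Complex.exp (Real.pi * Complex.I * c n * (2 ^ k * τ))) atTop
      (𝓝 (∑' n, if c n = 0 then a n else 0)) := by
  have hnorm (n : ℤ) (k : ℕ) : ‖Complex.exp (Real.pi * Complex.I * c n * (2 ^ k * τ))‖ =
      Real.exp (-(Real.pi * c n * τ.im) * 2 ^ k) := by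
    rw [Complex.norm_exp, show (Real.pi * Complex.I * c n * (2 ^ k * τ) : ℂ) =
      ((Real.pi * c n * 2 ^ k : ℝ) : ℂ) * (Complex.I * τ) by push_cast; ring, Complex.re_ofReal_mul]
    simp only [Complex.I_mul_re]
    ring_nf
  have hnorm₀ (n : ℤ) : ‖Complex.exp (Real.pi * Complex.I * c n * τ)‖ =
      Real.exp (-(Real.pi * c n * τ.im)) := by
    simpa using hnorm n 0
  -- The terms at k = 0 dominate, since c n ≥ 0.
  refine tendsto_tsum_of_dominated_convergence h.norm (fun n => ?_) (.of_forall fun k n => ?_)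
  · split_ifs with hn
    · simp [hn]
    · rw [tendsto_zero_iff_norm_tendsto_zero]
      have hc : 0 < Real.pi * c n * τ.im := by positivity
      have h2 : Tendsto (fun k : ℕ => (2 : ℝ) ^ k) atTop atTop :=
        tendsto_pow_atTop_atTop_of_one_lt one_lt_two
      have h3 := (Real.tendsto_exp_atBot.comp
        (h2.const_mul_atTop_of_neg (neg_neg_of_pos hc))).const_mul ‖a n‖
      simpa [norm_mul, hnorm] using h3
  · rw [norm_mul, norm_mul, hnorm, hnorm₀]
    have hc : 0 ≤ Real.pi * c n * τ.im := by positivity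
    have h2 : (1 : ℝ) ≤ 2 ^ k := one_le_pow₀ one_le_two
    gcongr
    nlinarith

theorem im_two_pow_mul_pos {τ : ℂ} (hτ : 0 < τ.im) (k : ℕ) : 0 < (2 ^ k * τ).im := by
  have := im_natCast_mul_pos hτ (n := 2 ^ k) (by positivity)
  simpa only [Nat.cast_pow, Nat.cast_ofNat] using this

theorem tendsto_thetaChar_zero (ζ : ℂ) {τ : ℂ} (hτ : 0 < τ.im) :
    Tendsto (fun k : ℕ => thetaChar 0 0 ζ (2 ^ k * τ)) atTop (𝓝 1) := by
  have hterm (σ : ℂ) (n : ℤ) : thetaCharTerm 0 0 ζ σ n =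
      Complex.exp (2 * Real.pi * Complex.I * n * ζ) *
        Complex.exp (Real.pi * Complex.I * (n.natAbs ^ 2 : ℕ) * σ) := by
    have : ((n.natAbs ^ 2 : ℕ) : ℂ) = (n : ℂ) ^ 2 := by
      rw [← Int.cast_natCast]; push_cast; rw [← Int.cast_pow, ← Int.cast_pow, sq_abs]
    rw [thetaCharTerm, this, ← Complex.exp_add]
    congr 1
    push_cast
    ring
  have h := tendsto_tsum_exp_two_pow hτ (fun n => n.natAbs ^ 2)
    (fun n => Complex.exp (2 * Real.pi * Complex.I * n * ζ))
    ((summable_thetaCharTerm 0 0 ζ hτ).congr fun n => hterm τ n)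
  simp only [← hterm] at h
  rw [tsum_eq_single 0] at h
  · simpa [thetaChar] using h
  · intro n hn
    simp [hn]

/-- Since (n+1/2)² = n(n+1) + 1/4, removing exp(πiσ/4) leaves natural exponents, zero only at n = 0,
−1; these two terms survive in the limit. -/
theorem thetaCharTerm_one_eq (ζ σ : ℂ) (n : ℤ) : thetaCharTerm 1 0 ζ σ n =
    Complex.exp (Real.pi * Complex.I * (σ / 4)) *
      (Complex.exp (2 * Real.pi * Complex.I * (n + 1 / 2) * ζ) *
        Complex.exp (Real.pi * Complex.I * ((n * (n + 1)).natAbs : ℕ) * σ)) := by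
  have h0 : 0 ≤ n * (n + 1) := by
    rcases le_or_gt 0 n with h | h
    · positivity
    · exact mul_nonneg_of_nonpos_of_nonpos h.le (by omega)
  have : (((n * (n + 1)).natAbs : ℕ) : ℂ) = (n : ℂ) * (n + 1) := by
    rw [← Int.cast_natCast, Int.natAbs_of_nonneg h0]
    push_cast
    ring
  rw [thetaCharTerm, this, ← Complex.exp_add, ← Complex.exp_add]
  congr 1
  push_cast
  ring

theorem tsum_ite_mul_succ_eq_zero (a : ℤ → ℂ) :
    (∑' n : ℤ, if (n * (n + 1)).natAbs = 0 then a n else 0) = a 0 + a (-1) := by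
  rw [tsum_eq_sum (s := {0, -1}), Finset.sum_pair (by norm_num)]
  · simp
  · intro n hn
    have : ¬ (n = 0 ∨ n + 1 = 0) := by
      simp only [Finset.mem_insert, Finset.mem_singleton] at hn
      omega
    simp [this]

theorem tendsto_thetaChar_one (ζ : ℂ) {τ : ℂ} (hτ : 0 < τ.im) :
    Tendsto (fun k : ℕ => thetaChar 1 0 ζ (2 ^ k * τ) /
      Complex.exp (Real.pi * Complex.I * (2 ^ k * τ / 4))) atTop
      (𝓝 (2 * Complex.cos (Real.pi * ζ))) := by
  have h := tendsto_tsum_exp_two_pow hτ (fun n => (n * (n + 1)).natAbs)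
    (fun n => Complex.exp (2 * Real.pi * Complex.I * (n + 1 / 2) * ζ)) ?_
  · rw [tsum_ite_mul_succ_eq_zero] at h
    convert h using 2 with k
    · rw [div_eq_iff (Complex.exp_ne_zero _), ← tsum_mul_right, thetaChar]
      exact tsum_congr fun n => (thetaCharTerm_one_eq _ _ _).trans (mul_comm _ _)
    · rw [Complex.two_cos]
      congr 2 <;> · push_cast; ring
  · refine (summable_mul_left_iff (Complex.exp_ne_zero (Real.pi * Complex.I * (τ / 4)))).1 ?_
    exact (summable_thetaCharTerm 1 0 ζ hτ).congr fun n => thetaCharTerm_one_eq _ _ _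

theorem tendsto_deriv_thetaChar_one (ζ : ℂ) {τ : ℂ} (hτ : 0 < τ.im) :
    Tendsto (fun k : ℕ => deriv (fun z => thetaChar 1 0 z (2 ^ k * τ)) ζ /
      Complex.exp (Real.pi * Complex.I * (2 ^ k * τ / 4))) atTop
      (𝓝 (-(2 * Real.pi * Complex.sin (Real.pi * ζ)))) := by
  have hterm (σ : ℂ) (n : ℤ) :
      2 * Real.pi * Complex.I * (n + ((1 : ℝ) : ℂ) / 2) * thetaCharTerm 1 0 ζ σ n =
        Complex.exp (Real.pi * Complex.I * (σ / 4)) *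
        (2 * Real.pi * Complex.I * (n + 1 / 2) *
          Complex.exp (2 * Real.pi * Complex.I * (n + 1 / 2) * ζ) *
        Complex.exp (Real.pi * Complex.I * ((n * (n + 1)).natAbs : ℕ) * σ)) := by
    rw [thetaCharTerm_one_eq]
    push_cast
    ring
  have h := tendsto_tsum_exp_two_pow hτ (fun n => (n * (n + 1)).natAbs)
    (fun n => 2 * Real.pi * Complex.I * (n + 1 / 2) *
      Complex.exp (2 * Real.pi * Complex.I * (n + 1 / 2) * ζ)) ?_
  · rw [tsum_ite_mul_succ_eq_zero] at h
    convert h using 2 with k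
    · rw [div_eq_iff (Complex.exp_ne_zero _), ← tsum_mul_right,
        ← (hasSum_deriv_thetaChar 1 ζ (im_two_pow_mul_pos hτ k)).tsum_eq]
      exact tsum_congr fun n => (hterm _ _).trans (mul_comm _ _)
    · have e1 : Complex.exp (2 * Real.pi * Complex.I * (((0 : ℤ) : ℂ) + 1 / 2) * ζ) =
          Complex.exp (Real.pi * ζ * Complex.I) := by
        congr 1; push_cast; ring
      have e2 : Complex.exp (2 * Real.pi * Complex.I * (((-1 : ℤ) : ℂ) + 1 / 2) * ζ) =
          Complex.exp (-(Real.pi * ζ) * Complex.I) := by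
        congr 1; push_cast; ring
      rw [e1, e2, mul_assoc, mul_left_comm, Complex.two_sin]
      push_cast
      ring
  · refine (summable_mul_left_iff (Complex.exp_ne_zero (Real.pi * Complex.I * (τ / 4)))).1 ?_
    exact (hasSum_deriv_thetaChar 1 ζ hτ).summable.congr fun n => hterm _ _

/-! ### Relations between moduli τ, 2τ and 4τ. -/

theorem thetaChar_one_zero_sq {τ : ℂ} (hτ : 0 < τ.im) :
    thetaChar 1 0 0 τ ^ 2 = 2 * thetaChar 0 0 0 (2 * τ) * thetaChar 1 0 0 (2 * τ) := by
  have h := thetaChar_mul_thetaChar 1 0 0 hτ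
  rw [show (1 + 1 : ℝ) = 0 + 2 by norm_num, thetaChar_add_two] at h
  simp only [add_zero, sub_zero] at h
  linear_combination h

theorem thetaChar_zero_mul_half {τ : ℂ} (hτ : 0 < τ.im) :
    thetaChar 0 0 0 τ * thetaChar 0 0 (1 / 2) τ = thetaChar 0 0 (1 / 2) (2 * τ) ^ 2 := by
  have h := thetaChar_mul_thetaChar 0 (1 / 2) 0 hτ
  simp only [add_zero, sub_zero, zero_add, thetaChar_one_half] at h
  linear_combination h

theorem thetaChar_zero_quarter {τ : ℂ} (hτ : 0 < τ.im) :
    thetaChar 0 0 (1 / 4) τ = thetaChar 0 0 (1 / 2) (4 * τ) := by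
  rw [thetaChar_zero_eq_add _ hτ, show (2 * (1 / 4) : ℂ) = 1 / 2 by norm_num, thetaChar_one_half,
    add_zero]

theorem thetaChar_one_zero_mul_quarter {τ : ℂ} (hτ : 0 < τ.im) :
    thetaChar 1 0 0 τ * thetaChar 1 0 (1 / 4) τ =
      2 * thetaChar 0 0 (1 / 2) (4 * (2 * τ)) * thetaChar 1 0 (1 / 4) (2 * τ) := by
  have h := thetaChar_mul_thetaChar 1 (1 / 4) 0 hτ
  rw [show (1 + 1 : ℝ) = 0 + 2 by norm_num, thetaChar_add_two] at h
  simp only [add_zero, sub_zero] at h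
  rw [← thetaChar_zero_quarter (im_two_mul_pos hτ)]
  linear_combination h

theorem deriv_thetaChar_zero_neg (ζ τ : ℂ) :
    deriv (fun z => thetaChar 0 0 z τ) (-ζ) = -deriv (fun z => thetaChar 0 0 z τ) ζ := by
  have h := deriv_comp_neg (fun z => thetaChar 0 0 z τ) ζ
  simp only [thetaChar_zero_neg] at h
  rw [h, neg_neg]

theorem deriv_thetaChar_zero_half (τ : ℂ) :
    deriv (fun z => thetaChar 0 0 z τ) (1 / 2) = 0 := by
  have h := deriv_comp_add_const (fun z => thetaChar 0 0 z τ) 1 (-(1 / 2))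
  simp only [thetaChar_zero_add_one, deriv_thetaChar_zero_neg] at h
  rw [show (-(1 / 2) + 1 : ℂ) = 1 / 2 by norm_num] at h
  exact self_eq_neg.1 h.symm

/-- In the even/odd splitting, the even-index part has a critical point here. -/
theorem deriv_thetaChar_zero_quarter {τ : ℂ} (hτ : 0 < τ.im) :
    deriv (fun z => thetaChar 0 0 z τ) (1 / 4) =
      2 * deriv (fun z => thetaChar 1 0 z (4 * τ)) (1 / 2) := by
  have h4 : 0 < (4 * τ).im := im_natCast_mul_pos hτ (n := 4) (by norm_num)
  have h2 : (1 / 2 : ℂ) = 2 * (1 / 4) := by norm_num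
  have hl : HasDerivAt (fun z : ℂ => 2 * z) (2 * 1) (1 / 4) := (hasDerivAt_id _).const_mul 2
  have h (ε : ℝ) : HasDerivAt (fun z => thetaChar ε 0 (2 * z) (4 * τ))
      (deriv (fun z => thetaChar ε 0 z (4 * τ)) (1 / 2) * (2 * 1)) (1 / 4) := by
    rw [h2]
    exact (hasDerivAt_thetaChar ε (2 * (1 / 4)) h4).comp (1 / 4) hl
  simp only [funext fun z => thetaChar_zero_eq_add z hτ]
  refine ((h 0).add (h 1)).deriv.trans ?_
  rw [deriv_thetaChar_zero_half]
  ring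

/-- The first-order form of the addition formula, in a direction `(s, t)`. -/
theorem deriv_thetaChar_mul_thetaChar (ε s t x y : ℝ) {τ : ℂ} (hτ : 0 < τ.im) :
    s * deriv (fun z => thetaChar ε 0 z τ) x * thetaChar ε 0 y τ +
        t * thetaChar ε 0 x τ * deriv (fun z => thetaChar ε 0 z τ) y =
      (s + t) * (deriv (fun z => thetaChar ε 0 z (2 * τ)) (x + y) * thetaChar 0 0 (x - y) (2 * τ) +
        deriv (fun z => thetaChar (ε + 1) 0 z (2 * τ)) (x + y) * thetaChar 1 0 (x - y) (2 * τ)) +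
      (s - t) * (thetaChar ε 0 (x + y) (2 * τ) * deriv (fun z => thetaChar 0 0 z (2 * τ)) (x - y) +
        thetaChar (ε + 1) 0 (x + y) (2 * τ) *
          deriv (fun z => thetaChar 1 0 z (2 * τ)) (x - y)) := by
  have hline (r p : ℂ) : HasDerivAt (fun w : ℂ => p + r * w) r 0 := by
    simpa using ((hasDerivAt_id (0 : ℂ)).const_mul r).const_add p
  have hT (δ : ℝ) (r p : ℂ) {σ : ℂ} (hσ : 0 < σ.im) :
      HasDerivAt (fun w => thetaChar δ 0 (p + r * w) σ)
        (deriv (fun z => thetaChar δ 0 z σ) p * r) 0 := by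
    have := (hasDerivAt_thetaChar δ (p + r * 0) hσ).comp 0 (hline r p)
    rwa [mul_zero, add_zero] at this
  have h2 := im_two_mul_pos hτ
  have hL := (hT ε s x hτ).mul (hT ε t y hτ)
  have hR := ((hT ε (s + t) (x + y) h2).mul (hT 0 (s - t) (x - y) h2)).add
    ((hT (ε + 1) (s + t) (x + y) h2).mul (hT 1 (s - t) (x - y) h2))
  have h := hL.unique (hR.congr_of_eventuallyEq (.of_forall fun w => ?_))
  · simp only [mul_zero, add_zero] at h
    linear_combination h
  · have := thetaChar_mul_thetaChar ε (x + s * w) (y + t * w) hτ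
    simp only [Pi.mul_apply, Pi.add_apply]
    rw [this]
    congr 3 <;> ring

theorem deriv_thetaChar_one_half_mul {τ : ℂ} (hτ : 0 < τ.im) :
    deriv (fun z => thetaChar 1 0 z τ) (1 / 2) * thetaChar 1 0 0 τ =
      2 * thetaChar 0 0 (1 / 2) (2 * τ) * deriv (fun z => thetaChar 1 0 z (2 * τ)) (1 / 2) := by
  have h := deriv_thetaChar_mul_thetaChar 1 1 0 (1 / 2) 0 hτ
  rw [show (1 + 1 : ℝ) = 0 + 2 by norm_num] at h
  simp only [thetaChar_add_two] at h
  push_cast at h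
  simp only [add_zero, sub_zero, thetaChar_one_half, deriv_thetaChar_zero_half] at h
  linear_combination h

/-! ### Doubling arguments: nonvanishing and the two constants. -/

theorem eq_of_tendsto_of_comp_two_mul {f : ℂ → ℂ} {τ L : ℂ} (hτ : 0 < τ.im)
    (hf : ∀ σ : ℂ, 0 < σ.im → f σ = f (2 * σ))
    (hL : Tendsto (fun k : ℕ => f (2 ^ k * τ)) atTop (𝓝 L)) : f τ = L := by
  have h (k : ℕ) : f (2 ^ k * τ) = f τ := by
    induction k with
    | zero => simp
    | succ k ih => rw [pow_succ', mul_assoc, ← hf _ (im_two_pow_mul_pos hτ k), ih]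
  simp only [h] at hL
  exact tendsto_nhds_unique tendsto_const_nhds hL

theorem eq_zero_two_pow_mul {f : ℂ → ℂ} {τ : ℂ} (hτ : 0 < τ.im)
    (hf : ∀ σ : ℂ, 0 < σ.im → f σ = 0 → f (2 * σ) = 0) (h0 : f τ = 0) (k : ℕ) :
    f (2 ^ k * τ) = 0 := by
  induction k with
  | zero => simpa using h0
  | succ k ih => rw [pow_succ', mul_assoc, hf _ (im_two_pow_mul_pos hτ k) ih]

theorem thetaChar_zero_half_ne_zero {τ : ℂ} (hτ : 0 < τ.im) : thetaChar 0 0 (1 / 2) τ ≠ 0 := by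
  intro h0
  have h := tendsto_thetaChar_zero (1 / 2) hτ
  simp only [eq_zero_two_pow_mul (f := thetaChar 0 0 (1 / 2)) hτ
    (fun σ hσ h => by
      have h1 := thetaChar_zero_mul_half hσ
      rw [h, mul_zero] at h1
      exact (pow_eq_zero_iff two_ne_zero).1 h1.symm) h0] at h
  exact zero_ne_one (tendsto_nhds_unique tendsto_const_nhds h)

theorem thetaChar_zero_zero_ne_zero {τ : ℂ} (hτ : 0 < τ.im) : thetaChar 0 0 0 τ ≠ 0 := by
  intro h
  have h1 := thetaChar_zero_mul_half hτ
  rw [h, zero_mul] at h1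
  exact pow_ne_zero 2 (thetaChar_zero_half_ne_zero (im_two_mul_pos hτ)) h1.symm

theorem thetaChar_one_zero_ne_zero {τ : ℂ} (hτ : 0 < τ.im) : thetaChar 1 0 0 τ ≠ 0 := by
  intro h0
  have h := tendsto_thetaChar_one 0 hτ
  simp only [eq_zero_two_pow_mul (f := thetaChar 1 0 0) hτ
    (fun σ hσ h => by
      simpa [h, thetaChar_zero_zero_ne_zero (im_two_mul_pos hσ)] using
        (thetaChar_one_zero_sq hσ).symm) h0, zero_div] at h
  simpa using tendsto_nhds_unique tendsto_const_nhds h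

/-- Jacobi's derivative formula. -/
theorem deriv_thetaChar_one_half {τ : ℂ} (hτ : 0 < τ.im) :
    deriv (fun z => thetaChar 1 0 z τ) (1 / 2) =
      -Real.pi * (thetaChar 1 0 0 τ * (thetaChar 0 0 0 τ * thetaChar 0 0 (1 / 2) τ)) := by
  have ha {σ : ℂ} (hσ : 0 < σ.im) := thetaChar_one_zero_ne_zero hσ
  have hb {σ : ℂ} (hσ : 0 < σ.im) := thetaChar_zero_zero_ne_zero hσ
  have hc {σ : ℂ} (hσ : 0 < σ.im) := thetaChar_zero_half_ne_zero hσ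
  rw [← div_eq_iff (mul_ne_zero (ha hτ) (mul_ne_zero (hb hτ) (hc hτ)))]
  refine eq_of_tendsto_of_comp_two_mul (f := fun σ => deriv (fun z => thetaChar 1 0 z σ) (1 / 2) /
    (thetaChar 1 0 0 σ * (thetaChar 0 0 0 σ * thetaChar 0 0 (1 / 2) σ))) hτ (fun σ hσ => ?_) ?_
  · have h2 := im_two_mul_pos hσ
    have e1 := deriv_thetaChar_one_half_mul hσ
    have e2 := thetaChar_one_zero_sq hσ
    have e3 := thetaChar_zero_mul_half hσ
    have ha1 := ha hσ
    have ha2 := ha h2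
    have hb2 := hb h2
    have hc2 := hc h2
    rw [e3, div_eq_div_iff (by positivity) (by positivity)]
    -- The extra factor θ₁(0,σ) makes both `e1` and the square in `e2` applicable.
    refine mul_left_cancel₀ ha1 ?_
    linear_combination (thetaChar 1 0 0 (2 * σ) * thetaChar 0 0 0 (2 * σ) *
      thetaChar 0 0 (1 / 2) (2 * σ)) * e1 - (thetaChar 0 0 (1 / 2) (2 * σ) ^ 2 *
        deriv (fun z => thetaChar 1 0 z (2 * σ)) (1 / 2)) * e2
  -- The limit is −2π sin(π/2) / (2·1·1) = −π.
  · have h := (tendsto_deriv_thetaChar_one (1 / 2) hτ).div ((tendsto_thetaChar_one 0 hτ).mul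
      ((tendsto_thetaChar_zero 0 hτ).mul (tendsto_thetaChar_zero (1 / 2) hτ))) (by simp)
    convert h using 2 with k
    · have := Complex.exp_ne_zero (Real.pi * Complex.I * (2 ^ k * τ / 4))
      simp only [Pi.div_apply]
      field_simp
    · rw [show (Real.pi * (1 / 2) : ℂ) = Real.pi / 2 by ring]
      simp
      ring

theorem thetaChar_one_zero_mul_quarter_eq {τ : ℂ} (hτ : 0 < τ.im) :
    thetaChar 1 0 0 τ * thetaChar 1 0 (1 / 4) τ =
      Real.sqrt 2 * (thetaChar 1 0 0 (2 * τ) * thetaChar 0 0 (1 / 2) (4 * τ)) := by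
  have ha {σ : ℂ} (hσ : 0 < σ.im) := thetaChar_one_zero_ne_zero hσ
  have hc {σ : ℂ} (hσ : 0 < σ.im) := thetaChar_zero_half_ne_zero hσ
  have h4 {σ : ℂ} (hσ : 0 < σ.im) : 0 < (4 * σ).im :=
    im_natCast_mul_pos hσ (n := 4) (by norm_num)
  have hsqrt : (Real.sqrt 2 : ℂ) * Real.sqrt 2 = 2 := by
    exact_mod_cast Real.mul_self_sqrt (zero_le_two)
  rw [← div_eq_iff (mul_ne_zero (ha (im_two_mul_pos hτ)) (hc (h4 hτ)))]
  refine eq_of_tendsto_of_comp_two_mul (f := fun σ => thetaChar 1 0 0 σ * thetaChar 1 0 (1 / 4) σ /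
    (thetaChar 1 0 0 (2 * σ) * thetaChar 0 0 (1 / 2) (4 * σ))) hτ (fun σ hσ => ?_) ?_
  · have h2 := im_two_mul_pos hσ
    have e1 := thetaChar_one_zero_mul_quarter hσ
    have e2 := thetaChar_one_zero_sq h2
    have e3 := thetaChar_zero_mul_half (h4 hσ)
    rw [show 2 * (2 * σ) = 4 * σ by ring] at e2
    rw [show 2 * (4 * σ) = 4 * (2 * σ) by ring] at e3
    have ha2 := ha h2
    have hc4 := hc (h4 hσ)
    have ha4 := ha (h4 hσ)
    have hc8 := hc (h4 h2)
    rw [e1, show 2 * (2 * σ) = 4 * σ by ring, div_eq_div_iff (by positivity) (by positivity)]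
    linear_combination (-2 * thetaChar 1 0 (1 / 4) (2 * σ) * thetaChar 1 0 0 (4 * σ)) * e3 -
      thetaChar 1 0 (1 / 4) (2 * σ) * thetaChar 0 0 (1 / 2) (4 * σ) * e2
  -- The exponential factors cancel, and 2·2cos(π/4)/2 = √2.
  · have h := ((tendsto_thetaChar_one 0 hτ).mul (tendsto_thetaChar_one (1 / 4) hτ)).div
      ((tendsto_thetaChar_one 0 (im_two_mul_pos hτ)).mul
      (tendsto_thetaChar_zero (1 / 2) (h4 hτ))) (by simp)
    convert h using 2 with k
    · have h0 := Complex.exp_ne_zero (Real.pi * Complex.I * (2 ^ k * τ / 4))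
      have h1 : Complex.exp (Real.pi * Complex.I * (2 ^ k * (2 * τ) / 4)) =
          Complex.exp (Real.pi * Complex.I * (2 ^ k * τ / 4)) ^ 2 := by
        rw [← Complex.exp_nat_mul]
        congr 1
        push_cast
        ring
      simp only [Pi.div_apply]
      rw [h1, mul_left_comm 2 (2 ^ k) τ, mul_left_comm 4 (2 ^ k) τ]
      field_simp
    · rw [show (Real.pi * (1 / 4) : ℂ) = ((Real.pi / 4 : ℝ) : ℂ) by push_cast; ring,
        ← Complex.ofReal_cos, Real.cos_pi_div_four]
      simp
      ring

/-! ### Values and derivatives at 1/8 and 3/8. -/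

theorem thetaCharDeriv_eq (ε' : ℝ) (τ : ℂ) :
    thetaCharDeriv 0 ε' τ = deriv (fun z => thetaChar 0 0 z τ) ((ε' / 2 : ℝ) : ℂ) := by
  have h := deriv_comp_add_const (fun z => thetaChar 0 0 z τ) ((ε' : ℂ) / 2) 0
  rw [thetaCharDeriv, funext fun z => thetaChar_char 0 ε' z τ, h]
  simp

theorem thetaChar_three_eighths_mul_eighth {τ : ℂ} (hτ : 0 < τ.im) :
    thetaChar 0 0 (3 / 8) τ * thetaChar 0 0 (1 / 8) τ =
      thetaChar 0 0 (1 / 2) (4 * (2 * τ)) * thetaChar 0 0 (1 / 2) (2 * τ) := by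
  have h := thetaChar_mul_thetaChar 0 (3 / 8) (-(1 / 8)) hτ
  rw [show (3 / 8 + -(1 / 8) : ℂ) = 1 / 4 by norm_num,
    show (3 / 8 - -(1 / 8) : ℂ) = 1 / 2 by norm_num, thetaChar_one_half, mul_zero, add_zero,
    thetaChar_zero_neg, thetaChar_zero_quarter (im_two_mul_pos hτ)] at h
  exact h

theorem deriv_thetaChar_eighths_sub {τ : ℂ} (hτ : 0 < τ.im) :
    deriv (fun z => thetaChar 0 0 z τ) (1 / 8) * thetaChar 0 0 (3 / 8) τ -
        thetaChar 0 0 (1 / 8) τ * deriv (fun z => thetaChar 0 0 z τ) (3 / 8) =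
      2 * Real.pi * thetaChar 1 0 0 (4 * τ) ^ 2 *
        (thetaChar 0 0 (1 / 8) τ * thetaChar 0 0 (3 / 8) τ) := by
  have h2 := im_two_mul_pos hτ
  have h4 := im_two_mul_pos h2
  have h8 := im_two_mul_pos h4
  -- Direction (1,1) fixes x−y, leaving θ₀'(1/4,2τ) = 2θ₁'(1/2,8τ), to which Jacobi's formula
  -- applies.
  have h := deriv_thetaChar_mul_thetaChar 0 1 1 (3 / 8) (-(1 / 8)) hτ
  push_cast at h
  rw [show (3 / 8 + -(1 / 8) : ℂ) = 1 / 4 by norm_num,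
    show (3 / 8 - -(1 / 8) : ℂ) = 1 / 2 by norm_num, thetaChar_one_half, thetaChar_zero_neg,
    deriv_thetaChar_zero_neg, deriv_thetaChar_zero_quarter h2] at h
  have e1 := thetaChar_three_eighths_mul_eighth hτ
  have e2 := thetaChar_one_zero_sq h4
  rw [show 4 * (2 * τ) = 2 * (2 * (2 * τ)) by ring] at h e1
  rw [show 4 * τ = 2 * (2 * τ) by ring]
  rw [deriv_thetaChar_one_half h8] at h
  linear_combination -h - 2 * Real.pi * thetaChar 1 0 0 (2 * (2 * τ)) ^ 2 * e1 -
    2 * Real.pi * thetaChar 0 0 (1 / 2) (2 * (2 * (2 * τ))) * thetaChar 0 0 (1 / 2) (2 * τ) * e2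

theorem deriv_thetaChar_eighths_add {τ : ℂ} (hτ : 0 < τ.im) :
    deriv (fun z => thetaChar 0 0 z τ) (1 / 8) * thetaChar 0 0 (3 / 8) τ +
        thetaChar 0 0 (1 / 8) τ * deriv (fun z => thetaChar 0 0 z τ) (3 / 8) =
      -(2 * Real.sqrt 2 * Real.pi * thetaChar 1 0 0 (4 * τ) * thetaChar 0 0 0 (2 * τ)) *
        (thetaChar 0 0 (1 / 8) τ * thetaChar 0 0 (3 / 8) τ) := by
  have h2 := im_two_mul_pos hτ
  -- Direction (1,−1) fixes x+y, leaving θ₁(1/4,2τ)·θ₁'(1/2,2τ); the first factor brings in √2.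
  have h := deriv_thetaChar_mul_thetaChar 0 1 (-1) (3 / 8) (-(1 / 8)) hτ
  push_cast at h
  rw [show (3 / 8 + -(1 / 8) : ℂ) = 1 / 4 by norm_num,
    show (3 / 8 - -(1 / 8) : ℂ) = 1 / 2 by norm_num, thetaChar_zero_neg,
    deriv_thetaChar_zero_neg, deriv_thetaChar_zero_half, deriv_thetaChar_one_half h2,
    zero_add] at h
  have e1 := thetaChar_three_eighths_mul_eighth hτ
  have e2 := thetaChar_one_zero_mul_quarter_eq h2
  rw [show 2 * (2 * τ) = 4 * τ by ring] at e2
  linear_combination h - 2 * Real.pi * thetaChar 0 0 0 (2 * τ) *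
    thetaChar 0 0 (1 / 2) (2 * τ) * e2 + 2 * Real.sqrt 2 * Real.pi * thetaChar 1 0 0 (4 * τ) *
    thetaChar 0 0 0 (2 * τ) * e1

theorem mainTheorem11 (τ : ℂ) (hτ : 0 < τ.im) :
    (thetaChar 0 (1 / 4) 0 τ ≠ 0 ∧ thetaChar 0 (3 / 4) 0 τ ≠ 0) ∧
    (thetaCharDeriv 0 (1 / 4) τ / thetaChar 0 (1 / 4) 0 τ
        - thetaCharDeriv 0 (3 / 4) τ / thetaChar 0 (3 / 4) 0 τ
      = 2 * (Real.pi : ℂ) * thetaChar 1 0 0 (4 * τ) ^ 2) ∧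
    (thetaCharDeriv 0 (1 / 4) τ / thetaChar 0 (1 / 4) 0 τ
        + thetaCharDeriv 0 (3 / 4) τ / thetaChar 0 (3 / 4) 0 τ
      = -(2 * (Real.sqrt 2 : ℂ) * (Real.pi : ℂ)
          * thetaChar 1 0 0 (4 * τ) * thetaChar 0 0 0 (2 * τ))) ∧
    (thetaCharDeriv 0 (1 / 4) τ
      = -(Real.pi : ℂ) * thetaChar 0 (1 / 4) 0 τ * thetaChar 1 0 0 (4 * τ)
          * ((Real.sqrt 2 : ℂ) * thetaChar 0 0 0 (2 * τ) - thetaChar 1 0 0 (4 * τ))) ∧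
    (thetaCharDeriv 0 (3 / 4) τ
      = -(Real.pi : ℂ) * thetaChar 0 (3 / 4) 0 τ * thetaChar 1 0 0 (4 * τ)
          * ((Real.sqrt 2 : ℂ) * thetaChar 0 0 0 (2 * τ) + thetaChar 1 0 0 (4 * τ))) := by

  have d1 : thetaCharDeriv 0 (1 / 4) τ = deriv (fun z => thetaChar 0 0 z τ) (1 / 8) := by
    rw [thetaCharDeriv_eq]; norm_num
  have d3 : thetaCharDeriv 0 (3 / 4) τ = deriv (fun z => thetaChar 0 0 z τ) (3 / 8) := by
    rw [thetaCharDeriv_eq]; norm_num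
  have t1 : thetaChar 0 (1 / 4) 0 τ = thetaChar 0 0 (1 / 8) τ := by
    rw [thetaChar_char]; norm_num
  have t3 : thetaChar 0 (3 / 4) 0 τ = thetaChar 0 0 (3 / 8) τ := by
    rw [thetaChar_char]; norm_num
  rw [d1, d3, t1, t3]
  have hsub := deriv_thetaChar_eighths_sub hτ
  have hadd := deriv_thetaChar_eighths_add hτ
  have hne : thetaChar 0 0 (3 / 8) τ * thetaChar 0 0 (1 / 8) τ ≠ 0 := by
    have h2 := im_two_mul_pos hτ
    rw [thetaChar_three_eighths_mul_eighth hτ]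
    exact mul_ne_zero
      (thetaChar_zero_half_ne_zero (im_natCast_mul_pos h2 (n := 4) (by norm_num)))
      (thetaChar_zero_half_ne_zero h2)
  obtain ⟨h3, h1⟩ := mul_ne_zero_iff.1 hne
  refine ⟨⟨h1, h3⟩, ?_, ?_, ?_, ?_⟩
  · rw [div_sub_div _ _ h1 h3, div_eq_iff (mul_ne_zero h1 h3), hsub]
  · rw [div_add_div _ _ h1 h3, div_eq_iff (mul_ne_zero h1 h3), hadd]
  · refine mul_right_cancel₀ h3 ?_
    linear_combination (hsub + hadd) / 2
  · refine mul_left_cancel₀ h1 ?_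
    linear_combination (hadd - hsub) / 2
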